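/- Let $A$ be a unital $C^*$-algebra. For a Hilbert space $H$ let $K(H)$ denote the $C^*$-algebra of compact operators on $H$. A $C^*$-algebra is called elementary if it is $*$-isomorphic to $K(H)$ for some Hilbert space $H$, and dual if it is $*$-isomorphic to a direct sum $\bigoplus_{t\in T} E_t$ of elementary $C^*$-algebras $E_t$, where the direct sum consists of all families $(x_t)_{t\in T}$, $x_t \in E_t$, such that for every $\varepsilon>0$ the set $\{t\in T : \|x_t\|\ge\varepsilon\}$ is finite, with pointwise operations and the supremum norm. A closed two-sided ideal of $A$ is called a dual ideal if it is dual when considered as a $C^*$-algebra. An element $a\in A$ is called Moore--Penrose invertible if there is $b\in A$ such that $aba=a$, $bab=b$, and $ab$ and $ba$ are self-adjoint. A closed two-sided ideal $J$ of $A$ is called a Moore--Penrose ideal of $A$ if every $a\in A$ whose coset $a+J$ is invertible in $A/J$ is Moore--Penrose invertible in $A$. Theorem. Every proper dual ideal of a unital $C^*$-algebra $A$ is a Moore--Penrose ideal of $A$. -/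

import Mathlib

open scoped ENNReal Topology

universe u v w

noncomputable section

/-- The adjoint of a compact operator on a Hilbert space is compact. -/
theorem isCompactOperator_star {H : Type*} [NormedAddCommGroup H] [InnerProductSpace ℂ H]
    [CompleteSpace H] {T : H →L[ℂ] H} (hT : IsCompactOperator T) :
    IsCompactOperator (star T : H →L[ℂ] H) := by
  have hc : IsCompactOperator (T * star T : H →L[ℂ] H) := hT.comp_clm (star T : H →L[ℂ] H)
  have key : ∀ x y : H, x ∈ Metric.ball (0 : H) 1 → y ∈ Metric.ball (0 : H) 1 →
      ‖(star T) x - (star T) y‖ ^ 2 ≤ 2 * ‖(T * star T) x - (T * star T) y‖ := by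
    intro x y hx hy
    rw [mem_ball_zero_iff] at hx hy
    have h1 : ‖(star T) x - (star T) y‖ ^ 2
        = RCLike.re (inner ℂ (x - y) ((T * star T) (x - y))) := by
      rw [← map_sub, ← inner_self_eq_norm_sq (𝕜 := ℂ), mul_apply_eq_comp,
        ContinuousLinearMap.star_eq_adjoint, ContinuousLinearMap.adjoint_inner_left]
    rw [h1, ← map_sub]
    refine (RCLike.re_le_norm _).trans ((norm_inner_le_norm _ _).trans ?_)
    have h2 : ‖x - y‖ ≤ 2 := (norm_sub_le x y).trans (by linarith)
    gcongr
  have htb : TotallyBounded ((T * star T : H →L[ℂ] H) '' Metric.ball 0 1) :=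
    (hc.isCompact_closure_image_ball 1).totallyBounded.subset subset_closure
  refine (isCompactOperator_iff_isCompact_closure_image_ball
    (star T : H →L[ℂ] H).toLinearMap one_pos).2 ?_
  refine TotallyBounded.isCompact_of_isClosed (TotallyBounded.closure ?_) isClosed_closure
  rw [Metric.totallyBounded_iff]
  intro ε hε
  obtain ⟨t, ht, htf, hcov⟩ := htb.exists_subset (Metric.dist_mem_uniformity
    (show (0 : ℝ) < ε ^ 2 / 2 by positivity))
  obtain ⟨s, hs, hsf, rfl⟩ := Set.exists_subset_image_finite_and.1 ⟨t, ht, htf, rfl⟩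
  refine ⟨(star T : H →L[ℂ] H) '' s, hsf.image _, ?_⟩
  rintro _ ⟨x, hx, rfl⟩
  obtain ⟨_, ⟨y, hy, rfl⟩, hxy⟩ := Set.mem_iUnion₂.1 (hcov ⟨x, hx, rfl⟩)
  refine Set.mem_iUnion₂.2 ⟨_, ⟨y, hy, rfl⟩, ?_⟩
  have h3 : ‖(T * star T) x - (T * star T) y‖ < ε ^ 2 / 2 := by
    simpa [dist_eq_norm] using hxy
  rw [Metric.mem_ball, dist_eq_norm]
  have h4 := key x y hx (hs hy)
  exact lt_of_pow_lt_pow_left₀ 2 hε.le (by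
    change ‖(star T) x - (star T) y‖ ^ 2 < ε ^ 2
    linarith)

/-- The C⋆-algebra `K(H)` of compact operators on a Hilbert space `H`. -/
def compactOperators (H : Type*) [NormedAddCommGroup H] [InnerProductSpace ℂ H]
    [CompleteSpace H] : NonUnitalStarSubalgebra ℂ (H →L[ℂ] H) where
  carrier := {T | IsCompactOperator T}
  zero_mem' := isCompactOperator_zero
  add_mem' := fun hS hT => hS.add hT
  mul_mem' := fun {_ T} hS _ => hS.comp_clm T
  smul_mem' := fun c _ hT => hT.smul c
  star_mem' := fun hT => isCompactOperator_star hT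

/-- The direct sum of a family of C⋆-algebras: all bounded families `f` whose norms `‖f t‖`
tend to zero along the cofinite filter, i.e. for every `ε > 0` there are only finitely many
`t` with `‖f t‖ ≥ ε`. The operations are pointwise, the norm is the supremum norm. -/
def cstarDirectSum {T : Type*} (E : T → Type*) [∀ t, NonUnitalCStarAlgebra (E t)] :
    NonUnitalStarSubalgebra ℂ (lp E ∞) where
  carrier := {f | Filter.Tendsto (fun t => ‖f t‖) Filter.cofinite (𝓝 0)}
  zero_mem' := by simpa using tendsto_const_nhds
  add_mem' := fun {f g} hf hg =>
    squeeze_zero (fun _ => norm_nonneg _) (fun t => norm_add_le (f t) (g t))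
      (by simpa using Filter.Tendsto.add hf hg)
  mul_mem' := fun {f g} hf hg =>
    squeeze_zero (fun _ => norm_nonneg _) (fun t => norm_mul_le (f t) (g t))
      (by simpa using Filter.Tendsto.mul hf hg)
  smul_mem' := fun c f hf =>
    squeeze_zero (fun _ => norm_nonneg _) (fun t => norm_smul_le c (f t))
      (by simpa using Filter.Tendsto.const_mul ‖c‖ hf)
  star_mem' := fun {f} hf => by simpa using hf

/-- A C⋆-algebra is elementary if it is ⋆-isomorphic to the algebra of the compact operators on
some Hilbert space. -/
def IsElementaryCStarAlgebra (E : Type u) [NonUnitalCStarAlgebra E] : Prop :=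
  ∃ (H : Type v) (_ : NormedAddCommGroup H) (_ : InnerProductSpace ℂ H) (_ : CompleteSpace H),
    Nonempty (E ≃⋆ₐ[ℂ] compactOperators H)

/-- A C⋆-algebra is dual if it is ⋆-isomorphic to a direct sum of elementary C⋆-algebras. -/
def IsDualCStarAlgebra (B : Type u) [NonUnitalCStarAlgebra B] : Prop :=
  ∃ (T : Type v) (E : T → Type w) (_ : ∀ t, NonUnitalCStarAlgebra (E t)),
    (∀ t, IsElementaryCStarAlgebra.{w, w} (E t)) ∧ Nonempty (B ≃⋆ₐ[ℂ] cstarDirectSum E)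

/-- A dual ideal of a unital C⋆-algebra `A` is a closed two-sided ideal which is a dual
C⋆-algebra when considered as a C⋆-algebra, i.e. as a closed ⋆-subalgebra `S` of `A`. (Closed
two-sided ideals are self-adjoint, and `S` is determined by its carrier.) -/
def IsDualIdeal {A : Type u} [CStarAlgebra A] (J : Ideal A) [J.IsTwoSided] : Prop :=
  ∃ (S : NonUnitalStarSubalgebra ℂ A) (_ : IsClosed (S : Set A)),
    (S : Set A) = (J : Set A) ∧ IsDualCStarAlgebra.{u, v, w} S

/-- `a` is Moore-Penrose invertible: there is `b` with `aba = a`, `bab = b` and `ab`, `ba`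
self-adjoint. -/
def IsMoorePenroseInvertible {A : Type u} [CStarAlgebra A] (a : A) : Prop :=
  ∃ b : A, a * b * a = a ∧ b * a * b = b ∧ IsSelfAdjoint (a * b) ∧ IsSelfAdjoint (b * a)

/-- A closed two-sided ideal `J` of `A` is a Moore-Penrose ideal if every element of `A` whose
coset is invertible in `A ⧸ J` is Moore-Penrose invertible in `A`. -/
def IsMoorePenroseIdeal {A : Type u} [CStarAlgebra A] (J : Ideal A) [J.IsTwoSided] : Prop :=
  IsClosed (J : Set A) ∧
    ∀ a : A, IsUnit (Ideal.Quotient.mk J a) → IsMoorePenroseInvertible a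

end

open Filter Module

/-! If `a` is invertible modulo `J`, so is `b = star a * a`. Multiplying by a continuous bump `f`
supported near `0` confines `b` to a small part, which a left inverse modulo `J` cannot allow
outside `J`; hence `f(b) ∈ J`. Self-adjoint elements of a dual algebra have spectra accumulating
only at `0`: this holds for compact operators, and in a direct sum only finitely many components
matter away from `0`. So `f(0) = δ ≠ 0` is not an accumulation point of the spectrum of `f(b)`, and
by spectral mapping `0` is not one for `b`. Inverting `b` on its nonzero spectrum gives `m`, and `m
* star a` is the Moore-Penrose inverse of `a`. -/

/-- If a nonzero `μ` is not an eigenvalue of a compact operator, then neither are the numbers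
close to `μ`. -/
theorem IsCompactOperator.eventually_not_hasEigenvalue {X : Type*} [NormedAddCommGroup X]
    [NormedSpace ℂ X] [CompleteSpace X] {T : X →L[ℂ] X} (hT : IsCompactOperator T) {μ : ℂ}
    (hμ : μ ≠ 0) (h : ¬ End.HasEigenvalue (T : End ℂ X) μ) :
    ∀ᶠ z in 𝓝 μ, ¬ End.HasEigenvalue (T : End ℂ X) z := by
  -- Fredholm alternative: `μ` lies in the resolvent set, which is open.
  filter_upwards [(spectrum.isOpen_resolventSet T).mem_nhds
    ((hT.hasEigenvalue_or_mem_resolventSet hμ).resolve_left h), isOpen_ne.mem_nhds hμ]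
    with z hz hz0 hmem
  exact (hT.hasEigenvalue_iff_mem_spectrum hz0).1 hmem hz

/-- A nonzero number is not an accumulation point of the spectrum of a self-adjoint compact
operator. -/
theorem IsCompactOperator.eventually_notMem_spectrum {H : Type*} [NormedAddCommGroup H]
    [InnerProductSpace ℂ H] [CompleteSpace H] {T : H →L[ℂ] H} (hT : IsCompactOperator T)
    (hsa : IsSelfAdjoint T) {μ : ℂ} (hμ : μ ≠ 0) :
    ∀ᶠ z in 𝓝[≠] μ, z ∉ spectrum ℂ T := by
  have hsym : (T : H →ₗ[ℂ] H).IsSymmetric := hsa.isSymmetric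
  -- Splitting off the `μ`-eigenspace leaves a compact operator without eigenvalue `μ`, yet `M`
  -- still contains every eigenvector for `z ≠ μ`.
  set M : Submodule ℂ H := (End.eigenspace (T : End ℂ H) μ)ᗮ with hM
  have hmaps : ∀ v ∈ M, (T : H →ₗ[ℂ] H) v ∈ M :=
    hsym.invariant_orthogonalComplement_eigenspace μ
  obtain ⟨R, hR, hRT⟩ : ∃ R : M →L[ℂ] M, IsCompactOperator R ∧ ∀ v, (R v : H) = T v :=
    ⟨T.restrict hmaps, hT.restrict' hmaps, fun _ => rfl⟩
  have hnot : ¬ End.HasEigenvalue (R : End ℂ M) μ := by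
    intro h
    obtain ⟨v, hv⟩ := h.exists_hasEigenvector
    have hv1 : (T : End ℂ H) v = μ • (v : H) :=
      (hRT v).symm.trans (congrArg Subtype.val hv.apply_eq_smul)
    have hv2 : (v : H) ∈ End.eigenspace (T : End ℂ H) μ := End.mem_eigenspace_iff.2 hv1
    have hv3 : (v : H) = 0 := by
      have := (Submodule.mem_orthogonal _ _).1 v.2 v hv2
      exact inner_self_eq_zero.1 this
    exact hv.2 (Subtype.ext hv3)
  have hev := hR.eventually_not_hasEigenvalue hμ hnot
  filter_upwards [nhdsWithin_le_nhds hev, self_mem_nhdsWithin,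
    nhdsWithin_le_nhds (isOpen_ne.mem_nhds hμ)] with z hz hzμ hz0 hmem
  obtain ⟨v, hv⟩ := ((hT.hasEigenvalue_iff_mem_spectrum hz0).2 hmem).exists_hasEigenvector
  have hvM : v ∈ M := by
    refine (Submodule.mem_orthogonal _ _).2 fun u hu => ?_
    exact hsym.orthogonalFamily_eigenspaces (Ne.symm hzμ) ⟨u, hu⟩ ⟨v, hv.1⟩
  have hRv : End.HasEigenvector (R : End ℂ M) z ⟨v, hvM⟩ := by
    rw [End.hasEigenvector_iff, End.mem_eigenspace_iff]
    exact ⟨Subtype.ext ((hRT _).trans hv.apply_eq_smul), fun h => hv.2 (congrArg Subtype.val h)⟩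
  exact hz (End.hasEigenvalue_of_hasEigenvector hRv)

/-- The nonzero part of the quasispectrum of a compact operator, relative to the compact operators,
is contained in its spectrum relative to all bounded operators. -/
theorem mem_spectrum_of_mem_quasispectrum_compactOperators {H : Type*} [NormedAddCommGroup H]
    [InnerProductSpace ℂ H] [CompleteSpace H] {x : compactOperators H} {z : ℂ} (hz : z ≠ 0)
    (h : z ∈ quasispectrum ℂ x) : z ∈ spectrum ℂ (x : H →L[ℂ] H) := by
  by_contra hn
  have hq : z ∉ quasispectrum ℂ (x : H →L[ℂ] H) := by
    rw [mem_quasispectrum_iff]; tauto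
  simp only [quasispectrum, Set.mem_ofPred_eq, not_forall, not_not] at hq h
  obtain ⟨hu, hq⟩ := hq
  refine h hu ?_
  obtain ⟨y, hy1, hy2⟩ := isQuasiregular_iff.1 hq
  set w : compactOperators H := -(hu.unit⁻¹ • x) with hw
  have hwc : ((w : compactOperators H) : H →L[ℂ] H) = -(hu.unit⁻¹ • (x : H →L[ℂ] H)) := rfl
  rw [← hwc] at hy1 hy2
  -- A quasi-inverse of a compact operator is compact: `y = -(w + w * y)`.
  have hyc : y ∈ compactOperators H := by
    have : y = -((w : H →L[ℂ] H) + w * y) := by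
      rw [eq_neg_iff_add_eq_zero, ← add_assoc]; exact hy1
    rw [this]
    exact neg_mem (add_mem w.2 (IsCompactOperator.comp_clm w.2 y))
  exact isQuasiregular_iff.2 ⟨⟨y, hyc⟩, Subtype.ext hy1, Subtype.ext hy2⟩

/-- A nonzero number is not an accumulation point of the quasispectrum of a self-adjoint element
of an elementary C⋆-algebra. -/
theorem IsElementaryCStarAlgebra.eventually_notMem_quasispectrum {E : Type u}
    [NonUnitalCStarAlgebra E] (hE : IsElementaryCStarAlgebra.{u, v} E) {x : E}
    (hx : IsSelfAdjoint x) {μ : ℂ} (hμ : μ ≠ 0) :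
    ∀ᶠ z in 𝓝[≠] μ, z ∉ quasispectrum ℂ x := by
  obtain ⟨H, _, _, _, ⟨e⟩⟩ := hE
  have hsa : IsSelfAdjoint ((e x : compactOperators H) : H →L[ℂ] H) :=
    congrArg Subtype.val (hx.map e)
  filter_upwards [IsCompactOperator.eventually_notMem_spectrum (e x).2 hsa hμ,
    nhdsWithin_le_nhds (isOpen_ne.mem_nhds hμ)] with z hz hz0 hmem
  refine hz (mem_spectrum_of_mem_quasispectrum_compactOperators hz0 ?_)
  have := NonUnitalAlgHom.quasispectrum_apply_subset (R := ℂ) e.symm (e x)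
  rw [e.symm_apply_apply] at this
  exact this hmem

/-- An element of a direct sum of C⋆-algebras is quasiregular as soon as all its components are. -/
theorem isQuasiregular_cstarDirectSum {T : Type*} {E : T → Type*}
    [∀ t, NonUnitalCStarAlgebra (E t)] {x : cstarDirectSum E}
    (h : ∀ t, IsQuasiregular ((x : lp E ∞) t)) : IsQuasiregular x := by
  choose y hy1 hy2 using fun t => isQuasiregular_iff.1 (h t)
  have hx : Tendsto (fun t => ‖(x : lp E ∞) t‖) cofinite (𝓝 0) := x.2
  have hy : Tendsto (fun t => ‖y t‖) cofinite (𝓝 0) := by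
    -- Where `‖x t‖ ≤ 1/2`, the relation `y = -(x + x * y)` gives `‖y‖ ≤ ‖x‖ + ‖y‖ / 2`.
    refine squeeze_zero' (g := fun t => 2 * ‖(x : lp E ∞) t‖)
      (Eventually.of_forall fun _ => norm_nonneg _) ?_ (by simpa using hx.const_mul 2)
    filter_upwards [hx.eventually_le_const (show (0 : ℝ) < 1 / 2 by norm_num)] with t ht
    have h1 : y t = -((x : lp E ∞) t + (x : lp E ∞) t * y t) := by
      rw [eq_neg_iff_add_eq_zero, ← add_assoc]; exact hy1 t
    have h2 : ‖y t‖ ≤ ‖(x : lp E ∞) t‖ + ‖(x : lp E ∞) t‖ * ‖y t‖ := by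
      conv_lhs => rw [h1, norm_neg]
      exact (norm_add_le _ _).trans (by gcongr; exact norm_mul_le _ _)
    nlinarith [norm_nonneg (y t)]
  let Y : cstarDirectSum E := ⟨⟨y, memℓp_infty hy.bddAbove_range_of_cofinite⟩, hy⟩
  exact isQuasiregular_iff.2
    ⟨Y, Subtype.ext (lp.ext (funext hy1)), Subtype.ext (lp.ext (funext hy2))⟩

/-- A nonzero number is not an accumulation point of the quasispectrum of a self-adjoint element
of a dual C⋆-algebra. -/
theorem IsDualCStarAlgebra.eventually_notMem_quasispectrum {B : Type u}
    [NonUnitalCStarAlgebra B] (hB : IsDualCStarAlgebra.{u, v, w} B) {b : B}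
    (hb : IsSelfAdjoint b) {μ : ℂ} (hμ : μ ≠ 0) :
    ∀ᶠ z in 𝓝[≠] μ, z ∉ quasispectrum ℂ b := by
  obtain ⟨T, E, _, hE, ⟨e⟩⟩ := hB
  set x : cstarDirectSum E := e b with hxdef
  have hxsa : IsSelfAdjoint x := hb.map e
  have hxt : ∀ t, IsSelfAdjoint ((x : lp E ∞) t) := fun t =>
    congrArg (fun y : cstarDirectSum E => (y : lp E ∞) t) hxsa
  have hx : Tendsto (fun t => ‖(x : lp E ∞) t‖) cofinite (𝓝 0) := x.2
  have hμ' : 0 < ‖μ‖ := norm_pos_iff.2 hμ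
  -- The remaining components have quasispectrum within radius `‖μ‖ / 2`, hence away from `μ`.
  have hfin : {t | ¬ ‖(x : lp E ∞) t‖ < ‖μ‖ / 2}.Finite :=
    hx.eventually_lt_const (half_pos hμ')
  have hlarge : ∀ᶠ z in 𝓝[≠] μ, ∀ t ∈ {t | ¬ ‖(x : lp E ∞) t‖ < ‖μ‖ / 2},
      z ∉ quasispectrum ℂ ((x : lp E ∞) t) := by
    rw [eventually_all_finite hfin]
    exact fun t _ => (hE t).eventually_notMem_quasispectrum (hxt t) hμ
  have hnear : ∀ᶠ z : ℂ in 𝓝[≠] μ, ‖μ‖ / 2 < ‖z‖ :=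
    nhdsWithin_le_nhds (continuous_norm.continuousAt.eventually_const_lt (half_lt_self hμ'))
  filter_upwards [hlarge, hnear] with z hz hz' hmem
  have hz0 : z ≠ 0 := norm_pos_iff.1 ((half_pos hμ').trans hz')
  have hcomp : ∀ t, z ∉ quasispectrum ℂ ((x : lp E ∞) t) := by
    intro t
    by_cases ht : ‖(x : lp E ∞) t‖ < ‖μ‖ / 2
    · intro hzt
      have : ‖z‖ ≤ ‖(x : lp E ∞) t‖ :=
        NonUnitalIsometricContinuousFunctionalCalculus.norm_quasispectrum_le ((x : lp E ∞) t) hzt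
          (hxt t).isStarNormal
      linarith
    · exact hz t ht
  have hmem' : z ∈ quasispectrum ℂ x := by
    have := NonUnitalAlgHom.quasispectrum_apply_subset (R := ℂ) e.symm x
    rw [hxdef, e.symm_apply_apply] at this
    exact this hmem
  refine hmem' (IsUnit.mk0 z hz0) (isQuasiregular_cstarDirectSum fun t => ?_)
  have := hcomp t
  simp only [quasispectrum, Set.mem_ofPred_eq, not_forall, not_not] at this
  exact this.2

/-- A nonzero real number is not an accumulation point of the spectrum of a self-adjoint element of
a dual ideal. -/
theorem IsDualIdeal.eventually_notMem_spectrum {A : Type u} [CStarAlgebra A] {J : Ideal A}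
    [J.IsTwoSided] (hJ : IsDualIdeal.{u, v, w} J) {k : A} (hk : k ∈ J) (hsa : IsSelfAdjoint k)
    {r : ℝ} (hr : r ≠ 0) : ∀ᶠ s in 𝓝[≠] r, s ∉ spectrum ℝ k := by
  obtain ⟨S, hS, hSJ, hdual⟩ := hJ
  have hkS : k ∈ S := by
    have : k ∈ (S : Set A) := hSJ ▸ hk
    exact this
  have hsa' : IsSelfAdjoint (⟨k, hkS⟩ : S) := Subtype.ext hsa
  have hev := hdual.eventually_notMem_quasispectrum hsa' (μ := (r : ℂ)) (by exact_mod_cast hr)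
  have htend : Tendsto (fun s : ℝ => (s : ℂ)) (𝓝[≠] r) (𝓝[≠] (r : ℂ)) :=
    Complex.continuous_ofReal.continuousAt.continuousWithinAt.tendsto_nhdsWithin
      fun s hs => by simpa using hs
  filter_upwards [htend.eventually hev] with s hs hmem
  refine hs ?_
  have h1 : (s : ℂ) ∈ quasispectrum ℂ k :=
    spectrum_subset_quasispectrum ℂ k ((spectrum.algebraMap_mem_iff ℂ).2 hmem)
  exact NonUnitalAlgHom.quasispectrum_apply_subset (R := ℂ)
    (NonUnitalStarSubalgebraClass.subtype S) (⟨k, hkS⟩ : S) h1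

/-- If a self-adjoint element `b` is left invertible modulo an ideal `J`, then for small `δ > 0`
the element `f(b)` lies in `J`, where `f(x) = max (δ - |x|) 0`. -/
theorem cfc_bump_mem_of_left_inverse {A : Type*} [CStarAlgebra A] {J : Ideal A}
    [J.IsTwoSided] {b d : A} (hb : IsSelfAdjoint b) (hd : 1 - d * b ∈ J) {δ : ℝ} (hδ : 0 < δ)
    (hdδ : ‖d‖ * δ < 1) : cfc (fun x : ℝ => max (δ - |x|) 0) b ∈ J := by
  set f : ℝ → ℝ := fun x => max (δ - |x|) 0 with hf
  -- Truncation of the identity to `[-δ, δ]`: it agrees with `x` wherever `f` is nonzero, and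
  -- `‖h(b)‖ ≤ δ` makes `1 - d * h(b)` invertible by a Neumann series.
  set h : ℝ → ℝ := fun x => max (-δ) (min x δ) with hh
  have hfc : Continuous f := by fun_prop
  have hhc : Continuous h := by fun_prop
  have hbf : b * cfc f b = cfc h b * cfc f b := by
    conv_lhs => enter [1]; rw [← cfc_id' ℝ b]
    rw [← cfc_mul (fun x : ℝ => x) f b continuousOn_id hfc.continuousOn,
      ← cfc_mul h f b hhc.continuousOn hfc.continuousOn]
    congr 1
    funext x
    rcases le_total |x| δ with hx | hx
    · have := abs_le.1 hx
      simp [hh, this.1, this.2]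
    · simp [hf, hx]
  have hnorm : ‖cfc h b‖ ≤ δ := by
    refine norm_cfc_le hδ.le fun x _ => ?_
    rw [Real.norm_eq_abs, abs_le]
    exact ⟨le_max_left _ _, max_le (by linarith) (min_le_right _ _)⟩
  have hunit : IsUnit (1 - d * cfc h b) :=
    isUnit_one_sub_of_norm_lt_one <| (norm_mul_le _ _).trans_lt <|
      (mul_le_mul_of_nonneg_left hnorm (norm_nonneg _)).trans_lt hdδ
  have hmem : (1 - d * cfc h b) * cfc f b ∈ J := by
    have : (1 - d * cfc h b) * cfc f b = (1 - d * b) * cfc f b := by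
      rw [sub_mul, sub_mul, mul_assoc, mul_assoc, hbf]
    rw [this]
    exact J.mul_mem_right _ hd
  obtain ⟨v, hv⟩ := hunit.exists_left_inv
  have := J.mul_mem_left v hmem
  rwa [← mul_assoc, hv, one_mul] at this

/-- An element `a` is Moore-Penrose invertible if `0` is not an accumulation point of the spectrum
of `star a * a`. -/
theorem isMoorePenroseInvertible_of_spectrum_gap {A : Type*} [CStarAlgebra A] {a : A} {η : ℝ}
    (hη : 0 < η) (hgap : ∀ x ∈ spectrum ℝ (star a * a), x = 0 ∨ η ≤ |x|) :
    IsMoorePenroseInvertible a := by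
  set b : A := star a * a with hb
  have hsa : IsSelfAdjoint b := .star_mul_self a
  -- A globally continuous substitute for `x⁻¹`, exact where `|x| ≥ η`, with `g 0 = 0`.
  set g : ℝ → ℝ := fun x => x / max (x ^ 2) (η ^ 2) with hg
  have hgc : Continuous g := by
    refine continuous_id.div (by fun_prop) fun x => ?_
    have := le_max_right (x ^ 2) (η ^ 2)
    positivity
  have hgx : ∀ x ∈ spectrum ℝ b, x = 0 ∨ g x = x⁻¹ := by
    intro x hx
    rcases hgap x hx with h | h
    · exact .inl h
    · have : η ^ 2 ≤ x ^ 2 := by rw [← sq_abs x]; gcongr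
      by_cases hx0 : x = 0
      · exact .inl hx0
      · right; simp only [hg, max_eq_left this]; field_simp
  set m : A := cfc g b with hm
  have hmsa : star m = m := IsSelfAdjoint.cfc
  have hcomm : m * b = b * m := by
    have := (cfc_commute_cfc g id b).eq
    rwa [cfc_id ℝ b] at this
  have hid : cfc (fun x : ℝ => x) b = b := cfc_id' ℝ b
  have hmb : m * b = cfc (fun x => g x * x) b := by
    rw [cfc_mul g (fun x : ℝ => x) b hgc.continuousOn continuousOn_id, hid]
  have hbmb : b * (m * b) = b := by
    conv_rhs => rw [← hid]
    rw [hmb]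
    conv_lhs => enter [1]; rw [← hid]
    rw [← cfc_mul (fun x : ℝ => x) _ b continuousOn_id (by fun_prop)]
    refine cfc_congr fun x hx => ?_
    rcases hgx x hx with h | h
    · simp [h]
    · by_cases hx0 : x = 0 <;> simp [h, hx0]
  have hmbm : m * b * m = m := by
    rw [hmb, hm, ← cfc_mul _ g b (by fun_prop) hgc.continuousOn]
    refine cfc_congr fun x hx => ?_
    rcases hgx x hx with h | h
    · simp [h, hg]
    · by_cases hx0 : x = 0
      · simp [hx0, hg]
      · simp [h, hx0]
  have hab : a * m * b = a := by
    -- By the C⋆-identity, `b * m * b = b` lifts to `a * m * b = a`.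
    have hz : star (a - a * m * b) * (a - a * m * b) = 0 := by
      have h1 : star (a - a * m * b) = star a - b * m * star a := by
        simp only [star_sub, star_mul, hmsa, hsa.star_eq, mul_assoc]
      calc star (a - a * m * b) * (a - a * m * b)
          = (star a * a) - (star a * a) * (m * b)
            - b * m * ((star a * a) - (star a * a) * (m * b)) := by rw [h1]; noncomm_ring
        _ = 0 := by rw [← hb, hbmb]; simp
    exact (sub_eq_zero.1 (CStarRing.star_mul_self_eq_zero_iff _ |>.1 hz)).symm
  refine ⟨m * star a, ?_, ?_, ?_, ?_⟩
  · rw [← mul_assoc, mul_assoc, ← hb, hab]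
  · rw [mul_assoc m, ← hb, ← mul_assoc, hmbm]
  · rw [← mul_assoc]
    simp [IsSelfAdjoint, hmsa, mul_assoc]
  · rw [mul_assoc, ← hb]
    rw [IsSelfAdjoint, star_mul, hmsa, hsa.star_eq, hcomm]

theorem theorem6 {A : Type u} [CStarAlgebra A] (J : Ideal A) [J.IsTwoSided]
    (hproper : J ≠ ⊤) (hdual : IsDualIdeal.{u, v, w} J) :
    IsMoorePenroseIdeal J := by
  have hstar : IsClosed (J : Set A) ∧ ∀ x ∈ J, star x ∈ J := by
    obtain ⟨S, hS, hSJ, -⟩ := hdual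
    have hiff : ∀ x, x ∈ J ↔ x ∈ S := fun x => (Set.ext_iff.1 hSJ x).symm
    exact ⟨hSJ ▸ hS, fun x hx => (hiff _).2 (star_mem ((hiff _).1 hx))⟩
  refine ⟨hstar.1, fun a ha => ?_⟩
  obtain ⟨⟨_, c', hac, hca⟩, rfl⟩ := ha
  obtain ⟨c, rfl⟩ := Ideal.Quotient.mk_surjective c'
  replace hac : 1 - a * c ∈ J := by
    rw [← Ideal.Quotient.eq_zero_iff_mem]; simp [hac]
  replace hca : 1 - c * a ∈ J := by
    rw [← Ideal.Quotient.eq_zero_iff_mem]; simp [hca]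
  set b : A := star a * a with hb
  have hsa : IsSelfAdjoint b := .star_mul_self a
  -- Modulo `J`, `star c * star a = star (a * c)` is `1`, so `c * star c * star a * a` reduces to `c
  -- * a`, again `1`.
  have hd : 1 - (c * star c) * b ∈ J := by
    have h1 : 1 - star c * star a ∈ J := by simpa using hstar.2 _ hac
    have h2 := J.add_mem hca (J.mul_mem_left c (J.mul_mem_right a h1))
    convert h2 using 1
    rw [hb]; noncomm_ring
  obtain ⟨δ, hδ, hdδ⟩ : ∃ δ : ℝ, 0 < δ ∧ ‖c * star c‖ * δ < 1 := by
    refine ⟨(‖c * star c‖ + 1)⁻¹, by positivity, ?_⟩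
    rw [← div_eq_mul_inv, div_lt_one (by positivity)]
    linarith
  have hk := cfc_bump_mem_of_left_inverse hsa hd hδ hdδ
  have hev := hdual.eventually_notMem_spectrum hk IsSelfAdjoint.cfc hδ.ne'
  obtain ⟨ε, hε, hball⟩ := Metric.mem_nhdsWithin_iff.1 hev
  refine isMoorePenroseInvertible_of_spectrum_gap (lt_min hδ hε) fun x hx => ?_
  by_contra! hcon
  obtain ⟨hx0, hxlt⟩ := hcon
  obtain ⟨hxδ, hxε⟩ := lt_min_iff.1 hxlt
  have hpos := abs_pos.2 hx0
  -- A spectral point `0 < |x| < min δ ε` of `b` would put `f(x) = δ - |x|` in the spectrum of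
  -- `f(b)`, within `ε` of `δ` but different from it.
  refine hball (a := δ - |x|) ⟨?_, ?_⟩ ?_
  · simpa [Real.dist_eq] using hxε
  · simpa using hx0
  · rw [cfc_map_spectrum (R := ℝ) (fun x : ℝ => max (δ - |x|) 0) b hsa (by fun_prop)]
    exact ⟨x, hx, max_eq_left (by linarith)⟩
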